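/- Let $\Lambda\subset\mathbb C$ be a lattice and let $\mathcal N$ be a finite bipartite perfect network embedded in the flat torus $T=\mathbb C/\Lambda$ with straight (geodesic) edges: $\mathcal N$ is a directed graph whose edges join white and black vertices, every white vertex has exactly one incoming edge, and every black vertex has exactly one outgoing edge. Let the rim $R$ be a non-contractible simple loop on $T$ which contains no vertex of $\mathcal N$, and assume that $\mathcal N$ and $R$ are in normalized position: every edge meeting $R$ meets it exactly once and is oriented from black to white; all edges meeting $R$ are parallel and point in the same direction $v\ne 0$; and $R$ is transversal to this direction, that is, every line in $\mathbb C$ parallel to $v$ meets each lift of $R$ to $\mathbb C$ in at most one point. (So all intersections of edges with $R$ have the same sign, and if $T$ is cut along $R$, one gets a network on a cylinder in which each edge meeting $R$ is cut into an edge from a source to a white vertex and an edge from a black vertex to a sink.) For an edge $e$ from a white to a black vertex let $e_-$ be its unique predecessor (the edge ending at the white endpoint of $e$) and $e_+$ its unique successor (the edge starting at the black endpoint of $e$), let $\alpha_-,\alpha_+\in(-\pi,\pi)$ be the signed angles from the vector $e_-$ to $e$ and from $e$ to $e_+$, and put $\mathrm{turn}(e)=\exp\bigl(\tfrac{\mathrm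 i}{2}(\alpha_-+\alpha_+)\bigr)$. The sign of a directed path $\gamma$ from a source to a sink in the network on the cylinder is defined by two rules: 1. if $\gamma$ is simple on the universal covering of the cylinder, its sign is $+1$; 2. if $\gamma$ can be decomposed into a path $\gamma'$ from a source to a sink and a contractible cycle that is simple on the universal covering, then the signs of $\gamma$ and $\gamma'$ are opposite. Then these rules assign exactly one sign to every directed path $\gamma$ from a source to a sink, and this sign is equal to the product, with multiplicities, of the turning numbers $\mathrm{turn}(e)$ of all white-to-black edges $e$ on $\gamma$. -/

import Mathlib

noncomputable section

/-- The two colours of vertices. -/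
inductive VertexColor
  | white
  | black

/-- A bipartite perfect network (a directed multigraph with vertex set `V` and edge set `E`)
embedded in the flat torus `ℂ ⧸ Λ` with straight edges. The edge `e` is drawn as the geodesic
`t ↦ pos (src e) + t • vec e`, `0 ≤ t ≤ 1`; here `vec e` is the vector in the plane which
represents `e` on the universal covering `ℂ` of the torus. -/
structure FlatPerfectNetwork (Λ : Submodule ℤ ℂ) (V E : Type*) where
  src : E → V
  tgt : E → V
  color : V → VertexColor
  /-- Every edge joins vertices of different colours. -/
  bipartite : ∀ e, color (src e) ≠ color (tgt e)
  /-- White vertices have exactly one incoming edge. -/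
  white_in : ∀ v, color v = VertexColor.white → ∃! e, tgt e = v
  /-- Black vertices have exactly one outgoing edge. -/
  black_out : ∀ v, color v = VertexColor.black → ∃! e, src e = v
  pos : V → ℂ ⧸ Λ
  vec : E → ℂ
  pos_tgt : ∀ e, pos (tgt e) = pos (src e) + Λ.mkQ (vec e)
  /-- Distinct vertices are distinct points. -/
  pos_injective : Function.Injective pos
  /-- An interior point of an edge lies on no other edge, is no vertex, and is passed only once
  by its own edge. -/
  embedded : ∀ e f : E, ∀ t u : ℝ, 0 < t → t < 1 → 0 ≤ u → u ≤ 1 →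
    pos (src e) + Λ.mkQ (t • vec e) = pos (src f) + Λ.mkQ (u • vec f) → e = f ∧ t = u

/-- An oriented non-contractible simple loop on the torus `ℂ ⧸ Λ`, given by a lift `ℝ → ℂ`; the
loop itself is `s ↦ Λ.mkQ (lift s)` and has period `1`. -/
structure SimpleLoop (Λ : Submodule ℤ ℂ) where
  lift : ℝ → ℂ
  continuous_lift : Continuous lift
  period : ℂ
  period_mem : period ∈ Λ
  period_ne_zero : period ≠ 0
  lift_add_one : ∀ s, lift (s + 1) = lift s + period
  simple : ∀ s s' : ℝ, Λ.mkQ (lift s) = Λ.mkQ (lift s') → ∃ n : ℤ, s - s' = n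

/-- The oriented area `a × b` of the parallelogram spanned by two vectors of the plane. For fixed
`a ≠ 0`, two points lie on the same line parallel to `a` iff they have the same image. -/
def planeCross (a b : ℂ) : ℝ := a.re * b.im - a.im * b.re

namespace FlatPerfectNetwork

variable {Λ : Submodule ℤ ℂ} {V E : Type*} (N : FlatPerfectNetwork Λ V E)

/-- The point of the edge `e` with parameter `t ∈ [0, 1]` lies on the loop `R`. -/
def MeetsAt (R : SimpleLoop Λ) (e : E) (t : ℝ) : Prop :=
  0 ≤ t ∧ t ≤ 1 ∧ ∃ s : ℝ, N.pos (N.src e) + Λ.mkQ (t • N.vec e) = Λ.mkQ (R.lift s)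

/-- The edge `e` crosses the loop `R`. -/
def Crosses (R : SimpleLoop Λ) (e : E) : Prop := ∃ t, N.MeetsAt R e t

/-- The network and the rim `R` are in normalized position, with `v` the common direction of the
edges which cross the rim.

A crossing edge meets the rim once and is oriented from black to white. When the torus is cut
along the rim it therefore breaks into one edge from a source to a white vertex and one edge from
a black vertex to a sink. The rim is transversal to the direction `v`: a line parallel to `v`
meets a lift of the rim to the plane at most once. As all crossing edges are positive multiples
of `v`, all intersections of edges with the rim then have the same sign, so the rim is ideal. -/
structure IsNormalized (R : SimpleLoop Λ) (v : ℂ) : Prop where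
  vertices_off_rim : ∀ (x : V) (s : ℝ), N.pos x ≠ Λ.mkQ (R.lift s)
  meets_once : ∀ e t u, N.MeetsAt R e t → N.MeetsAt R e u → t = u
  black_to_white : ∀ e, N.Crosses R e → N.color (N.src e) = VertexColor.black
  parallel : ∀ e, N.Crosses R e → ∃ c : ℝ, 0 < c ∧ N.vec e = c • v
  transversal : Function.Injective fun s => planeCross v (R.lift s)

lemma color_tgt_of_white {e : E} (h : N.color (N.src e) = VertexColor.white) :
    N.color (N.tgt e) = VertexColor.black := by
  have hb := N.bipartite e
  cases ht : N.color (N.tgt e)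
  · exact absurd (h.trans ht.symm) hb
  · rfl

/-- The unique predecessor of a white-to-black edge. -/
def predEdge (e : E) (h : N.color (N.src e) = VertexColor.white) : E :=
  (N.white_in (N.src e) h).choose

/-- The unique successor of a white-to-black edge. -/
def succEdge (e : E) (h : N.color (N.src e) = VertexColor.white) : E :=
  (N.black_out (N.tgt e) (N.color_tgt_of_white h)).choose

/-- The signed angle from the vector `a` to the vector `b`. -/
def signedAngle (a b : ℂ) : ℝ := Complex.arg (b / a)

/-- The turning number `exp ((i / 2) (α₋ + α₊))` of a white-to-black edge. -/
def turn (e : E) (h : N.color (N.src e) = VertexColor.white) : ℂ :=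
  Complex.exp (Complex.I / 2 *
    ((signedAngle (N.vec (N.predEdge e h)) (N.vec e) +
      signedAngle (N.vec e) (N.vec (N.succEdge e h)) : ℝ) : ℂ))

/-- A directed path from a source to a sink in the network on the cylinder obtained by cutting the
torus along the rim `R`. Sources and sinks correspond to the edges crossing the rim. The path
starts along the second half of the crossing edge `source`, follows the edges `mid`, which do not
cross the rim, and ends along the first half of the crossing edge `sink`. -/
structure CylinderPath (R : SimpleLoop Λ) where
  source : E
  mid : List E
  sink : E
  source_crosses : N.Crosses R source
  sink_crosses : N.Crosses R sink
  mid_not_crosses : ∀ e ∈ mid, ¬ N.Crosses R e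
  chain : List.IsChain (fun e f => N.tgt e = N.src f) (source :: (mid ++ [sink]))

/-- The displacement, in the universal covering, along a directed path. -/
def displacement (l : List E) : ℂ := (l.map N.vec).sum

/-- A path from a source to a sink is simple on the universal covering: the lifted path visits no
vertex twice. If the first vertex is lifted to `z : ℂ`, then the `i`-th one is lifted to
`z + displacement (mid.take i)`. (The universal covering of the cylinder is a connected component
of the plane minus all lifts of the rim.) -/
def CylinderPath.IsSimple {N : FlatPerfectNetwork Λ V E} {R : SimpleLoop Λ}
    (γ : N.CylinderPath R) : Prop :=
  ∀ i j, i < j → j ≤ γ.mid.length →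
    N.displacement (γ.mid.take i) ≠ N.displacement (γ.mid.take j)

/-- A directed path is a contractible cycle which is simple (on the universal covering): its lift
returns to the starting point, and visits no vertex twice before that. -/
def IsContractibleSimpleCycle (c : List E) : Prop :=
  c ≠ [] ∧ N.displacement c = 0 ∧
    ∀ i j, i < j → j < c.length → N.displacement (c.take i) ≠ N.displacement (c.take j)

/-- The path `γ` decomposes into the path `γ'` and a contractible simple cycle. -/
def CylinderPath.DecomposesInto {N : FlatPerfectNetwork Λ V E} {R : SimpleLoop Λ}
    (γ γ' : N.CylinderPath R) : Prop :=
  γ.source = γ'.source ∧ γ.sink = γ'.sink ∧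
    ∃ a c b : List E, γ.mid = a ++ c ++ b ∧ γ'.mid = a ++ b ∧ N.IsContractibleSimpleCycle c

/-- The modified concordance sign of a path from a source to a sink, as the relation generated by
the two inductive rules. -/
inductive HasSign {N : FlatPerfectNetwork Λ V E} {R : SimpleLoop Λ} :
    N.CylinderPath R → ℤˣ → Prop
  | simple (γ : N.CylinderPath R) : γ.IsSimple → HasSign γ 1
  | cycle (γ γ' : N.CylinderPath R) (ε : ℤˣ) :
      γ.DecomposesInto γ' → HasSign γ' ε → HasSign γ (-ε)

open Classical in
/-- The product of the turning numbers of all white-to-black edges of a path (with multiplicity;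
the edges `source` and `sink` are included in the list of all edges of the path). -/
def CylinderPath.turnProduct {N : FlatPerfectNetwork Λ V E} {R : SimpleLoop Λ}
    (γ : N.CylinderPath R) : ℂ :=
  ((γ.source :: (γ.mid ++ [γ.sink])).map fun e =>
    if h : N.color (N.src e) = VertexColor.white then N.turn e h else 1).prod

end FlatPerfectNetwork

end

/-!
The turn product of a path is `exp (i / 2 * A)`, where `A` is the sum of all signed angles between
consecutive edges of the path, so both sign rules are statements about `A`.

A contractible simple cycle lifts to a simple closed polygon in the plane. By Hopf's Umlaufsatz
its total turning is an odd multiple of `2π`, so it contributes the factor `-1`. Splicing a cycle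
into a path adds exactly its total turning to `A`: at the vertex where it is inserted either the
incoming or the outgoing edge is unique, so the path and the cycle share an edge there, and the
angles at the junction recombine.

A simple path from a source to a sink lifts to a simple arc. It stays above the lift of the rim
crossed by its first edge and below the lift crossed by its last edge, so none of its secants from
the first vertex or to the last vertex points opposite to `v`. As both end edges have direction
`v`, Hopf's secants turn by opposite angles in the two halves of his argument, and `A = 0`.
-/

section BrokenLines

open Complex Finset
open scoped Pointwise

lemma exists_re_mul_pos_of_zero_notMem_convexHull {s : Set ℂ} (hs : s.Finite)
    (h : (0 : ℂ) ∉ convexHull ℝ s) : ∃ w : ℂ, ∀ z ∈ s, 0 < (z * w).re := by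
  obtain ⟨f, u, hu, hf⟩ :=
    geometric_hahn_banach_point_closed (convex_convexHull ℝ s) (hs.isClosed_convexHull ℝ) h
  refine ⟨starRingEnd ℂ ((InnerProductSpace.toDual ℝ ℂ).symm f), fun z hz => ?_⟩
  rw [← Complex.inner, InnerProductSpace.toDual_symm_apply]
  exact (map_zero f ▸ hu).trans (hf z (subset_convexHull ℝ s hz))

lemma arg_div_eq_sub_of_re_mul_pos {a b w : ℂ} (ha : 0 < (a * w).re) (hb : 0 < (b * w).re) :
    arg (b / a) = arg (b * w) - arg (a * w) := by
  have ha0 : a * w ≠ 0 := fun h => by simp [h] at ha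
  have hb0 : b * w ≠ 0 := fun h => by simp [h] at hb
  have haπ := abs_lt.1 (abs_arg_lt_pi_div_two_iff.2 (Or.inl ha))
  have hbπ := abs_lt.1 (abs_arg_lt_pi_div_two_iff.2 (Or.inl hb))
  rw [← mul_div_mul_right b a (right_ne_zero_of_mul ha0), ← arg_coe_angle_toReal_eq_arg,
    arg_div_coe_angle hb0 ha0, ← Real.Angle.coe_sub, Real.Angle.toReal_coe_eq_self_iff]
  constructor <;> linarith

lemma arg_div_add_arg_div_of_zero_notMem_convexHull {a b c : ℂ}
    (h : (0 : ℂ) ∉ convexHull ℝ {a, b, c}) : arg (b / a) + arg (c / b) = arg (c / a) := by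
  obtain ⟨w, hw⟩ := exists_re_mul_pos_of_zero_notMem_convexHull (Set.toFinite _) h
  have ha := hw a (by simp)
  have hb := hw b (by simp)
  have hc := hw c (by simp)
  rw [arg_div_eq_sub_of_re_mul_pos ha hb, arg_div_eq_sub_of_re_mul_pos hb hc,
    arg_div_eq_sub_of_re_mul_pos ha hc]
  ring

lemma arg_add_div_add_arg_div_add {a b : ℂ} (h : (0 : ℂ) ∉ segment ℝ a b) :
    arg ((a + b) / a) + arg (b / (a + b)) = arg (b / a) := by
  rw [← convexHull_pair] at h
  obtain ⟨w, hw⟩ := exists_re_mul_pos_of_zero_notMem_convexHull (Set.toFinite _) h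
  have ha := hw a (by simp)
  have hb := hw b (by simp)
  have hab : 0 < ((a + b) * w).re := by rw [add_mul, add_re]; exact add_pos ha hb
  rw [arg_div_eq_sub_of_re_mul_pos ha hab, arg_div_eq_sub_of_re_mul_pos hab hb,
    arg_div_eq_sub_of_re_mul_pos ha hb]
  ring

-- Both sides are the change of the argument of `x - y`, for `x` and `y` in the two segments, along
-- different pairs of sides of a parallelogram which does not contain the origin.
lemma arg_sub_div_add_arg_sub_div_of_disjoint_segment {a a' b b' : ℂ}
    (h : Disjoint (segment ℝ a a') (segment ℝ b b')) :
    arg ((a' - b) / (a - b)) + arg ((a' - b') / (a' - b)) =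
      arg ((a - b') / (a - b)) + arg ((a' - b') / (a - b')) := by
  have h0 : (0 : ℂ) ∉ convexHull ℝ ({a, a'} - {b, b'} : Set ℂ) := by
    rwa [convexHull_sub, convexHull_pair, convexHull_pair, Set.zero_mem_sub_iff, not_not]
  obtain ⟨w, hw⟩ := exists_re_mul_pos_of_zero_notMem_convexHull (Set.toFinite _) h0
  have hab := hw (a - b) (Set.sub_mem_sub (by simp) (by simp))
  have hab' := hw (a - b') (Set.sub_mem_sub (by simp) (by simp))
  have ha'b := hw (a' - b) (Set.sub_mem_sub (by simp) (by simp))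
  have ha'b' := hw (a' - b') (Set.sub_mem_sub (by simp) (by simp))
  rw [arg_div_eq_sub_of_re_mul_pos hab ha'b, arg_div_eq_sub_of_re_mul_pos ha'b ha'b',
    arg_div_eq_sub_of_re_mul_pos hab hab', arg_div_eq_sub_of_re_mul_pos hab' ha'b']
  ring

/-- The total angle through which the vector from `p` to a moving point turns while the point
runs through the broken line with vertices `z 0, …, z n`. -/
noncomputable def sweptAngle (p : ℂ) (z : ℕ → ℂ) (n : ℕ) : ℝ :=
  ∑ i ∈ range n, arg ((z (i + 1) - p) / (z i - p))

/-- The total turning, that is, the sum of the signed angles at the `n` inner vertices of the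
broken line with vertices `z 0, …, z (n + 1)`. -/
noncomputable def totalTurning (z : ℕ → ℂ) (n : ℕ) : ℝ :=
  ∑ i ∈ range n, arg ((z (i + 2) - z (i + 1)) / (z (i + 1) - z i))

/-- The broken line with vertices `z 0, …, z (n + 1)` is a simple arc: two edges which are not
consecutive are disjoint, and no edge is degenerate or folded back along the preceding one
(unless the arc consists of one edge, which may be degenerate). -/
structure IsSimpleArc (z : ℕ → ℂ) (n : ℕ) : Prop where
  disjoint : ∀ i j, i + 1 < j → j ≤ n →
    Disjoint (segment ℝ (z i) (z (i + 1))) (segment ℝ (z j) (z (j + 1)))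
  corner : ∀ i < n, (0 : ℂ) ∉ segment ℝ (z (i + 1) - z i) (z (i + 2) - z (i + 1))

lemma sweptAngle_sub_sweptAngle {p q : ℂ} {z : ℕ → ℂ} {n : ℕ}
    (h : ∀ i < n, Disjoint (segment ℝ (z i) (z (i + 1))) (segment ℝ p q)) :
    sweptAngle q z n - sweptAngle p z n =
      arg ((z n - q) / (z n - p)) - arg ((z 0 - q) / (z 0 - p)) := by
  rw [sweptAngle, sweptAngle, ← sum_sub_distrib,
    ← sum_range_sub fun i => arg ((z i - q) / (z i - p))]
  refine sum_congr rfl fun i hi => ?_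
  linarith [arg_sub_div_add_arg_sub_div_of_disjoint_segment (h i (mem_range.1 hi))]

lemma sweptAngle_eq_sub {v p : ℂ} {z : ℕ → ℂ} {n : ℕ}
    (h : ∀ i < n, ∀ x ∈ segment ℝ (z i) (z (i + 1)), (0 : ℂ) ∉ segment ℝ v (x - p)) :
    sweptAngle p z n = arg ((z n - p) / v) - arg ((z 0 - p) / v) := by
  rw [sweptAngle, ← sum_range_sub fun i => arg ((z i - p) / v)]
  refine sum_congr rfl fun i hi => eq_sub_of_add_eq' ?_
  refine arg_div_add_arg_div_of_zero_notMem_convexHull ?_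
  rw [convexHull_insert (by simp), convexHull_pair, convexJoin_singleton_left]
  simp only [Set.mem_iUnion, not_exists]
  intro y hy
  rw [← mem_segment_translate ℝ p, add_sub_cancel, add_sub_cancel] at hy
  simpa only [add_sub_cancel_left] using h i (mem_range.1 hi) (p + y) hy

lemma coe_sweptAngle {p : ℂ} {z : ℕ → ℂ} {n : ℕ} (h : ∀ i ≤ n, z i ≠ p) :
    (sweptAngle p z n : Real.Angle) = arg (z n - p) - arg (z 0 - p) := by
  rw [sweptAngle, ← sum_range_sub fun i => (arg (z i - p) : Real.Angle)]
  refine (map_sum Real.Angle.coeHom _ _).trans (sum_congr rfl fun i hi => ?_)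
  have hi := mem_range.1 hi
  exact arg_div_coe_angle (sub_ne_zero.2 (h _ hi)) (sub_ne_zero.2 (h _ hi.le))

namespace IsSimpleArc

variable {z : ℕ → ℂ} {n : ℕ}

lemma of_le {m : ℕ} (h : IsSimpleArc z n) (hmn : m ≤ n) : IsSimpleArc z m :=
  ⟨fun i j hij hj => h.disjoint i j hij (hj.trans hmn), fun i hi => h.corner i (hi.trans_le hmn)⟩

lemma sweptAngle_last (h : IsSimpleArc z (n + 1)) :
    sweptAngle (z (n + 2)) z (n + 1) = sweptAngle (z (n + 1)) z n +
      arg ((z (n + 2) - z (n + 1)) / (z (n + 1) - z n)) -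
      arg ((z (n + 2) - z 0) / (z (n + 1) - z 0)) := by
  have hmove := sweptAngle_sub_sweptAngle fun i (hi : i < n) =>
    h.disjoint i (n + 1) (by omega) le_rfl
  have hcorner := arg_add_div_add_arg_div_add (h.corner n n.lt_succ_self)
  rw [sub_add_sub_cancel'] at hcorner
  have hlast : sweptAngle (z (n + 2)) z (n + 1) = sweptAngle (z (n + 2)) z n +
      arg ((z (n + 2) - z (n + 1)) / (z (n + 2) - z n)) := by
    rw [sweptAngle, sum_range_succ, ← neg_div_neg_eq, neg_sub, neg_sub]; rfl
  rw [← neg_div_neg_eq, neg_sub, neg_sub, ← neg_div_neg_eq (z 0 - _), neg_sub, neg_sub] at hmove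
  linarith

-- Hopf's argument: the direction of the first edge is moved to that of the last one through the
-- secants from the first vertex, and then through the secants to the last vertex.
theorem totalTurning_eq (h : IsSimpleArc z n) :
    totalTurning z n =
      sweptAngle (z 0) (fun i => z (i + 1)) n + sweptAngle (z (n + 1)) z n := by
  induction n with
  | zero => simp [totalTurning, sweptAngle]
  | succ m ih =>
    have hlast := h.sweptAngle_last
    have hm := ih (h.of_le m.le_succ)
    simp only [totalTurning, sweptAngle, sum_range_succ] at hm hlast ⊢
    linarith

theorem totalTurning_eq_zero {v : ℂ} (h : IsSimpleArc z n)
    (hfirst : arg ((z 1 - z 0) / v) = 0) (hlast : arg ((z (n + 1) - z n) / v) = 0)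
    (hbelow : ∀ i < n, ∀ x ∈ segment ℝ (z (i + 1)) (z (i + 2)), (0 : ℂ) ∉ segment ℝ v (x - z 0))
    (habove : ∀ i < n, ∀ x ∈ segment ℝ (z i) (z (i + 1)),
      (0 : ℂ) ∉ segment ℝ v (z (n + 1) - x)) :
    totalTurning z n = 0 := by
  have hsource : sweptAngle (z 0) (fun i => z (i + 1)) n =
      arg ((z (n + 1) - z 0) / v) := by
    rw [sweptAngle_eq_sub (v := v) hbelow, zero_add, hfirst, sub_zero]
  have hsink : sweptAngle (z (n + 1)) z n = -arg ((z (n + 1) - z 0) / v) := by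
    rw [sweptAngle_eq_sub (v := -v)]
    · simp only [← neg_sub (z (n + 1)), neg_div_neg_eq]
      rw [hlast, zero_sub]
    · intro i hi x hx h0
      refine habove i hi x hx ?_
      rw [← neg_zero, ← neg_sub (z (n + 1))] at h0
      obtain ⟨a, b, ha, hb, hab, h0⟩ := h0
      exact ⟨a, b, ha, hb, hab, by rwa [smul_neg, smul_neg, ← neg_add, neg_inj] at h0⟩
  rw [h.totalTurning_eq, hsource, hsink, add_neg_cancel]

lemma totalTurning_add_arg_of_closed (hz : z (n + 3) = z 0)
    (hinit : IsSimpleArc z (n + 1)) (htail : IsSimpleArc (fun i => z (i + 1)) (n + 1))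
    (hcorner : (0 : ℂ) ∉ segment ℝ (z 0 - z (n + 2)) (z 1 - z 0)) :
    totalTurning z (n + 2) + arg ((z 1 - z 0) / (z 0 - z (n + 2))) =
      2 * (sweptAngle (z 0) (fun i => z (i + 1)) (n + 1) +
        arg ((z 1 - z 0) / (z 0 - z (n + 2)))) := by
  set φ := sweptAngle (z 0) (fun i => z (i + 1)) (n + 1) with hφ
  have hHopf : totalTurning z (n + 1) = φ + sweptAngle (z (n + 2)) z (n + 1) :=
    hinit.totalTurning_eq
  have hinitSwept : sweptAngle (z (n + 2)) z (n + 1) =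
      sweptAngle (z (n + 2)) (fun i => z (i + 1)) n +
        arg ((z 1 - z (n + 2)) / (z 0 - z (n + 2))) := sum_range_succ' _ _
  have htailSwept : φ = sweptAngle (z (n + 2)) (fun i => z (i + 1)) n +
      arg ((z 0 - z (n + 2)) / (z (n + 2) - z (n + 1))) -
        arg ((z 1 - z 0) / (z 1 - z (n + 2))) := by
    rw [← neg_div_neg_eq (z 1 - z 0), neg_sub, neg_sub, hφ, ← hz]
    exact htail.sweptAngle_last
  have hsucc : totalTurning z (n + 2) = totalTurning z (n + 1) +
      arg ((z 0 - z (n + 2)) / (z (n + 2) - z (n + 1))) := by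
    rw [← hz]; exact sum_range_succ _ _
  have htriangle := arg_add_div_add_arg_div_add hcorner
  rw [sub_add_sub_cancel'] at htriangle
  linarith

lemma ne_zero_of_closed (hinit : IsSimpleArc z (n + 1))
    (hcorner : (0 : ℂ) ∉ segment ℝ (z 0 - z (n + 2)) (z 1 - z 0)) :
    ∀ i ≤ n + 1, z (i + 1) ≠ z 0 := by
  rintro (_ | i) hi h0
  · exact hcorner (sub_eq_zero.2 h0 ▸ right_mem_segment ..)
  · rcases hi.eq_or_lt with hi | hi
    · obtain rfl : i = n := by omega
      exact hcorner (sub_eq_zero.2 h0.symm ▸ left_mem_segment ..)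
    · exact Set.disjoint_left.1 (hinit.disjoint 0 (i + 2) (by omega) (by omega))
        (left_mem_segment ..) (h0 ▸ left_mem_segment ..)

/-- Hopf's Umlaufsatz for polygons with `n + 3` edges, in the weak form that the rotation number
of a simple closed polygon is odd. -/
theorem half_totalTurning_coe_of_closed (hz : z (n + 3) = z 0)
    (hinit : IsSimpleArc z (n + 1)) (htail : IsSimpleArc (fun i => z (i + 1)) (n + 1))
    (hcorner : (0 : ℂ) ∉ segment ℝ (z 0 - z (n + 2)) (z 1 - z 0)) :
    (((totalTurning z (n + 2) + arg ((z 1 - z 0) / (z 0 - z (n + 2)))) / 2 : ℝ) :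
      Real.Angle) = Real.pi := by
  have hne := hinit.ne_zero_of_closed hcorner
  have hlast : z (n + 2) - z 0 ≠ 0 := sub_ne_zero.2 (hne (n + 1) le_rfl)
  have hfirst : z 1 - z 0 ≠ 0 := sub_ne_zero.2 (hne 0 (by omega))
  rw [totalTurning_add_arg_of_closed hz hinit htail hcorner, mul_div_cancel_left₀ _ two_ne_zero,
    Real.Angle.coe_add, arg_div_coe_angle hfirst (by rwa [← neg_sub, neg_ne_zero]),
    ← neg_sub (z (n + 2)), arg_neg_coe_angle hlast, coe_sweptAngle fun i hi => hne i hi]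
  simp

end IsSimpleArc

end BrokenLines

section Height

open Complex

lemma planeCross_add (v a b : ℂ) : planeCross v (a + b) = planeCross v a + planeCross v b := by
  simp only [planeCross, add_re, add_im]; ring

lemma planeCross_add_smul_self (v z : ℂ) (t : ℝ) :
    planeCross v (z + t • v) = planeCross v z := by
  simp only [planeCross, add_re, add_im, smul_re, smul_im, smul_eq_mul]; ring

lemma continuous_planeCross (v : ℂ) : Continuous (planeCross v) := by
  unfold planeCross; fun_prop

lemma eq_add_smul_of_planeCross_eq {v z w : ℂ} (hv : v ≠ 0) (h : planeCross v z = planeCross v w) :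
    z = w + ((z - w) / v).re • v := by
  have him : ((z - w) / v).im = 0 := by
    rw [div_im, ← sub_div, div_eq_zero_iff, sub_im, sub_re]
    simp only [planeCross] at h
    left; linarith
  have hre : (((z - w) / v).re : ℂ) = (z - w) / v := Complex.ext rfl him.symm
  rw [real_smul, hre, div_mul_cancel₀ _ hv, add_sub_cancel]

lemma exists_continuous_rightInverse {g : ℝ → ℝ} (hg : Continuous g)
    (hinj : Function.Injective g) (hsurj : Function.Surjective g) :
    ∃ σ : ℝ → ℝ, Continuous σ ∧ Function.RightInverse σ g := by
  rcases hg.strictMono_of_inj hinj with h | h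
  · let φ := h.orderIsoOfSurjective g hsurj
    exact ⟨φ.symm, φ.symm.continuous, φ.apply_symm_apply⟩
  · let φ := h.dual_right.orderIsoOfSurjective (OrderDual.toDual ∘ g) hsurj
    exact ⟨φ.symm ∘ OrderDual.toDual, φ.symm.continuous.comp continuous_toDual,
      φ.apply_symm_apply⟩

lemma surjective_of_map_add_one {g : ℝ → ℝ} {c : ℝ} (hg : Continuous g) (hc : c ≠ 0)
    (h : ∀ s, g (s + 1) = g s + c) : Function.Surjective g := by
  have hint (n : ℤ) : g n = g 0 + n * c := by
    have := AddConstMapClass.map_int_add' (⟨g, h⟩ : AddConstMap ℝ ℝ 1 c) n 0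
    simpa [add_comm] using this
  have hunbounded (r : ℝ) : ∃ n : ℤ, r ≤ n * c := by
    rcases hc.lt_or_gt with hc | hc
    · exact ⟨⌊r / c⌋, (le_div_iff_of_neg hc).1 (Int.floor_le _)⟩
    · exact ⟨⌈r / c⌉, (div_le_iff₀ hc).1 (Int.le_ceil _)⟩
  intro y
  obtain ⟨m, hm⟩ := hunbounded (y - g 0)
  obtain ⟨n, hn⟩ := hunbounded (g 0 - y)
  refine mem_range_of_exists_le_of_exists_ge hg ⟨(-n : ℤ), ?_⟩ ⟨m, ?_⟩
  · rw [hint, Int.cast_neg]; linarith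
  · rw [hint]; linarith

lemma sign_eq_sign_of_isPreconnected {X : Type*} [TopologicalSpace X] {F : X → ℝ}
    (hF : Continuous F) {s : Set X} (hs : IsPreconnected s) (h : ∀ x ∈ s, F x ≠ 0) {x y : X}
    (hx : x ∈ s) (hy : y ∈ s) : SignType.sign (F x) = SignType.sign (F y) :=
  hs.constant (f := fun x => SignType.sign (F x)) (fun z hz =>
    ((continuousAt_sign_of_ne_zero (h z hz)).comp hF.continuousAt).continuousWithinAt) hx hy

/-- `F` is a height function above the lift of the rim `R` through one of its zeros: it measures
the signed distance to this lift along lines parallel to `v`, with `v` as the unit. Only one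
inclusion is required for the zero set, namely that all zeros are lifts of points of `R`. -/
structure SimpleLoop.IsHeight {Λ : Submodule ℤ ℂ} (R : SimpleLoop Λ) (v : ℂ) (F : ℂ → ℝ) :
    Prop where
  continuous : Continuous F
  map_add_smul : ∀ (z : ℂ) (t : ℝ), F (z + t • v) = F z + t
  mem_rim : ∀ z, F z = 0 → ∃ s, Λ.mkQ z = Λ.mkQ (R.lift s)

namespace SimpleLoop

variable {Λ : Submodule ℤ ℂ} {R : SimpleLoop Λ} {v : ℂ}

lemma exists_isHeight (hv : v ≠ 0) (h : Function.Injective fun s => planeCross v (R.lift s)) :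
    ∃ F, R.IsHeight v F ∧ ∀ s, F (R.lift s) = 0 := by
  have hcross : Continuous fun s => planeCross v (R.lift s) :=
    (continuous_planeCross v).comp R.continuous_lift
  have hperiodic (s : ℝ) : planeCross v (R.lift (s + 1)) =
      planeCross v (R.lift s) + planeCross v R.period := by rw [R.lift_add_one, planeCross_add]
  have hperiod : planeCross v R.period ≠ 0 := fun h0 =>
    (lt_add_one (0 : ℝ)).ne' (h (by simp only [hperiodic, h0, add_zero]))
  obtain ⟨σ, hσ, hinv⟩ :=
    exists_continuous_rightInverse hcross h (surjective_of_map_add_one hcross hperiod hperiodic)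
  have hplane := continuous_planeCross v
  have hlift := R.continuous_lift
  refine ⟨fun z => ((z - R.lift (σ (planeCross v z))) / v).re, ⟨by fun_prop, fun z t => ?_,
    fun z hz => ⟨σ (planeCross v z), ?_⟩⟩, fun s => ?_⟩
  · rw [planeCross_add_smul_self, add_sub_right_comm, add_div, add_re, real_smul,
      mul_div_cancel_right₀ _ hv, ofReal_re]
  · refine congrArg Λ.mkQ ?_
    simpa only [hz, zero_smul, add_zero] using
      eq_add_smul_of_planeCross_eq hv (hinv (planeCross v z)).symm
  · have hs : σ (planeCross v (R.lift s)) = s := h (hinv _)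
    simp only [hs, sub_self, zero_div, zero_re]

lemma IsHeight.comp_add {F : ℂ → ℝ} (hF : R.IsHeight v F) {d : ℂ} (hd : d ∈ Λ) :
    R.IsHeight v fun z => F (z + d) where
  continuous := hF.continuous.comp (continuous_add_const d)
  map_add_smul z t := by rw [add_right_comm, hF.map_add_smul]
  mem_rim z hz := by
    simpa [(Submodule.Quotient.mk_eq_zero Λ).2 hd] using hF.mem_rim _ hz

lemma IsHeight.zero_notMem_segment {F : ℂ → ℝ} (hF : R.IsHeight v F) {x y : ℂ} (h : F x < F y) :
    (0 : ℂ) ∉ segment ℝ v (y - x) := by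
  rintro ⟨a, b, ha, hb, hab, h0⟩
  rcases hb.eq_or_lt with rfl | hb
  · obtain rfl : a = 1 := by linarith
    have hv : v = 0 := by simpa using h0
    simpa [hv] using hF.map_add_smul x 1
  · have hy : y = x + (-(a / b)) • v := by
      linear_combination (norm := skip) b⁻¹ • h0
      match_scalars <;> field
    rw [hy, hF.map_add_smul] at h
    have := div_nonneg ha hb.le
    linarith

end SimpleLoop

end Height

section Network

open Complex

namespace FlatPerfectNetwork

variable {Λ : Submodule ℤ ℂ} {V E : Type*} (N : FlatPerfectNetwork Λ V E)

lemma mem_segment_self_add_iff {a d x : ℂ} :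
    x ∈ segment ℝ a (a + d) ↔ ∃ t : ℝ, 0 ≤ t ∧ t ≤ 1 ∧ a + t • d = x := by
  rw [segment_eq_image']
  simp only [add_sub_cancel_left, Set.mem_image, Set.mem_Icc, and_assoc]

lemma vec_ne_zero (e : E) : N.vec e ≠ 0 := fun h => by
  have := (N.embedded e e (1 / 2) 0 (by norm_num) (by norm_num) le_rfl zero_le_one
    (by simp [h])).2
  norm_num at this

lemma zero_notMem_segment_vec {e f : E} (h : N.tgt e = N.src f) :
    (0 : ℂ) ∉ segment ℝ (N.vec e) (N.vec f) := by
  rintro ⟨α, β, hα, hβ, hαβ, h0⟩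
  have hα_pos : 0 < α := hα.lt_of_ne' <| by
    rintro rfl
    obtain rfl : β = 1 := by linarith
    exact N.vec_ne_zero f (by simpa using h0)
  have hoverlap : (1 - α / 2) • N.vec e = N.vec e + (β / 2) • N.vec f := by
    linear_combination (norm := module) (-1 / 2 : ℝ) • h0
  have := (N.embedded e f (1 - α / 2) (β / 2) (by linarith) (by linarith) (by linarith)
    (by linarith) (by rw [hoverlap, map_add, ← add_assoc, ← N.pos_tgt, h])).2
  linarith

lemma disjoint_segment {e f : E} {a a' b b' : ℂ} (ha : Λ.mkQ a = N.pos (N.src e))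
    (hb : Λ.mkQ b = N.pos (N.src f)) (ha' : a' = a + N.vec e) (hb' : b' = b + N.vec f)
    (hab : a ≠ b) (hab' : a ≠ b') (ha'b : a' ≠ b) (ha'b' : a' ≠ b') :
    Disjoint (segment ℝ a a') (segment ℝ b b') := by
  subst ha' hb'
  rw [Set.disjoint_left]
  intro x hx hx'
  obtain ⟨t, ht0, ht1, rfl⟩ := mem_segment_self_add_iff.1 hx
  obtain ⟨u, hu0, hu1, h⟩ := mem_segment_self_add_iff.1 hx'
  have hpos : N.pos (N.src e) + Λ.mkQ (t • N.vec e) = N.pos (N.src f) + Λ.mkQ (u • N.vec f) := by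
    rw [← ha, ← hb, ← map_add, ← map_add, h]
  have ht : ¬ (0 < t ∧ t < 1) := fun ⟨ht0, ht1⟩ => by
    obtain ⟨rfl, rfl⟩ := N.embedded e f t u ht0 ht1 hu0 hu1 hpos
    exact hab (add_right_cancel h.symm)
  have hu : ¬ (0 < u ∧ u < 1) := fun ⟨hu0, hu1⟩ => by
    obtain ⟨rfl, rfl⟩ := N.embedded f e u t hu0 hu1 ht0 ht1 hpos.symm
    exact hab (add_right_cancel h.symm)
  obtain rfl | rfl : t = 0 ∨ t = 1 := by grind
  all_goals obtain rfl | rfl : u = 0 ∨ u = 1 := by grind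
  all_goals simp only [zero_smul, one_smul, add_zero] at h
  exacts [hab h.symm, hab' h.symm, ha'b h.symm, ha'b' h.symm]

/-- The list `l` of edges is a directed path: each edge starts where the preceding one ends. -/
abbrev IsDirectedPath (l : List E) : Prop := l.IsChain fun e f => N.tgt e = N.src f

@[simp] lemma displacement_nil : N.displacement [] = 0 := rfl

@[simp] lemma displacement_cons (e : E) (l : List E) :
    N.displacement (e :: l) = N.vec e + N.displacement l := List.sum_cons

@[simp] lemma displacement_append (l l' : List E) :
    N.displacement (l ++ l') = N.displacement l + N.displacement l' := by
  rw [displacement, List.map_append, List.sum_append]; rfl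

/-- The lift to the plane of the `i`-th vertex of a directed path `l` whose first vertex is lifted
to `a`. -/
noncomputable def liftVertex (a : ℂ) (l : List E) (i : ℕ) : ℂ := a + N.displacement (l.take i)

/-- The sum of the signed angles between consecutive edges of a list. -/
noncomputable def angleSum : List E → ℝ
  | [] => 0
  | [_] => 0
  | e :: f :: l => signedAngle (N.vec e) (N.vec f) + angleSum (f :: l)

variable {N} {a : ℂ} {l : List E}

lemma liftVertex_zero : N.liftVertex a l 0 = a := by
  simp [liftVertex]

lemma liftVertex_length : N.liftVertex a l l.length = a + N.displacement l := by
  rw [liftVertex, List.take_length]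

lemma liftVertex_succ {i : ℕ} (hi : i < l.length) :
    N.liftVertex a l (i + 1) = N.liftVertex a l i + N.vec l[i] := by
  rw [liftVertex, liftVertex, List.take_succ_eq_append_getElem hi, displacement_append,
    displacement_cons, displacement_nil, add_zero, add_assoc]

lemma liftVertex_succ_sub {i : ℕ} (hi : i < l.length) :
    N.liftVertex a l (i + 1) - N.liftVertex a l i = N.vec l[i] := by
  rw [liftVertex_succ hi, add_sub_cancel_left]

lemma liftVertex_cons_succ (e : E) (i : ℕ) :
    N.liftVertex a (e :: l) (i + 1) = N.liftVertex (a + N.vec e) l i := by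
  simp [liftVertex, add_assoc]

lemma mkQ_liftVertex (hl : N.IsDirectedPath l)
    (ha : ∀ h : 0 < l.length, Λ.mkQ a = N.pos (N.src l[0])) {i : ℕ} (hi : i < l.length) :
    Λ.mkQ (N.liftVertex a l i) = N.pos (N.src l[i]) := by
  induction i with
  | zero => rw [liftVertex_zero, ha hi]
  | succ i ih =>
    rw [liftVertex_succ (by omega), map_add, ih (by omega), ← N.pos_tgt,
      List.isChain_iff_getElem.1 hl i hi]

lemma mkQ_liftVertex_succ (hl : N.IsDirectedPath l)
    (ha : ∀ h : 0 < l.length, Λ.mkQ a = N.pos (N.src l[0])) {i : ℕ} (hi : i < l.length) :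
    Λ.mkQ (N.liftVertex a l (i + 1)) = N.pos (N.tgt l[i]) := by
  rw [liftVertex_succ hi, map_add, mkQ_liftVertex hl ha hi, ← N.pos_tgt]

lemma isSimpleArc_liftVertex (hl : N.IsDirectedPath l)
    (ha : ∀ h : 0 < l.length, Λ.mkQ a = N.pos (N.src l[0])) {s n : ℕ} (hn : n + s < l.length)
    (hinj : Set.InjOn (N.liftVertex a l) (Set.Icc s (n + 1 + s))) :
    IsSimpleArc (fun i => N.liftVertex a l (i + s)) n where
  disjoint i j hij hj := by
    have hne {i j : ℕ} (hij : i < j) (hj : j ≤ n + 1) :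
        N.liftVertex a l (i + s) ≠ N.liftVertex a l (j + s) :=
      hinj.ne ⟨by omega, by omega⟩ ⟨by omega, by omega⟩ (by omega)
    rw [add_right_comm i, add_right_comm j]
    refine N.disjoint_segment (mkQ_liftVertex hl ha (by omega)) (mkQ_liftVertex hl ha (by omega))
      (liftVertex_succ (by omega)) (liftVertex_succ (by omega)) (hne (by omega) (by omega)) ?_ ?_ ?_
    all_goals
      simp only [add_right_comm _ s]
      exact hne (by omega) (by omega)
  corner i hi := by
    simp only [add_right_comm _ _ s]
    rw [liftVertex_succ_sub (by omega), liftVertex_succ_sub (i := i + s + 1) (by omega)]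
    exact N.zero_notMem_segment_vec (List.isChain_iff_getElem.1 hl _ (by omega))

lemma angleSum_eq_totalTurning (a : ℂ) {n : ℕ} (hn : l.length = n + 1) :
    N.angleSum l = totalTurning (N.liftVertex a l) n := by
  induction l generalizing n a with
  | nil => simp at hn
  | cons e t ih =>
    match t with
    | [] =>
      obtain rfl : n = 0 := by simpa using hn.symm
      simp [angleSum, totalTurning]
    | f :: t =>
      obtain ⟨m, rfl⟩ : ∃ m, n = m + 1 := ⟨t.length, by simpa using hn.symm⟩
      have hfirst : N.liftVertex a (e :: f :: t) 1 - N.liftVertex a (e :: f :: t) 0 = N.vec e :=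
        liftVertex_succ_sub (by simp)
      have hsecond : N.liftVertex a (e :: f :: t) 2 - N.liftVertex a (e :: f :: t) 1 = N.vec f :=
        liftVertex_succ_sub (by simp)
      rw [totalTurning, Finset.sum_range_succ', zero_add, zero_add, hfirst, hsecond, angleSum,
        ih (a + N.vec e) (by simpa using hn), add_comm]
      simp only [totalTurning, liftVertex_cons_succ, signedAngle, add_right_comm _ 1 2]

lemma exists_mkQ_eq_pos_src (l : List E) :
    ∃ a : ℂ, ∀ h : 0 < l.length, Λ.mkQ a = N.pos (N.src l[0]) := by
  by_cases h : 0 < l.length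
  · obtain ⟨a, ha⟩ := Λ.mkQ_surjective (N.pos (N.src l[0]))
    exact ⟨a, fun _ => ha⟩
  · exact ⟨0, fun h' => absurd h' h⟩

lemma tgt_getLast_eq_src_head (hl : N.IsDirectedPath l) (h0 : l ≠ [])
    (hd : N.displacement l = 0) : N.tgt (l.getLast h0) = N.src (l.head h0) := by
  obtain ⟨a, ha⟩ := N.exists_mkQ_eq_pos_src l
  have hlen : 0 < l.length := List.length_pos_iff.2 h0
  apply N.pos_injective
  have h := mkQ_liftVertex_succ hl ha (i := l.length - 1) (by omega)
  rw [Nat.sub_add_cancel hlen, liftVertex_length, hd, add_zero, ha hlen] at h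
  rw [List.getLast_eq_getElem, List.head_eq_getElem, ← h]

lemma three_le_length_of_displacement_eq_zero (hl : N.IsDirectedPath l) (h0 : l ≠ [])
    (hd : N.displacement l = 0) : 3 ≤ l.length := by
  match l, hd, hl with
  | [e], hd, _ => exact absurd (by simpa using hd) (N.vec_ne_zero e)
  | [e, f], hd, hl =>
    refine absurd ⟨1 / 2, 1 / 2, by norm_num, by norm_num, by norm_num, ?_⟩
      (N.zero_notMem_segment_vec (e := e) (f := f) (by simpa using hl))
    rw [← smul_add, show N.vec e + N.vec f = 0 by simpa using hd, smul_zero]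
  | _ :: _ :: _ :: _, _, _ => simp

namespace IsContractibleSimpleCycle

lemma injOn_liftVertex (hc : N.IsContractibleSimpleCycle l) :
    Set.InjOn (N.liftVertex a l) (Set.Iio l.length) := fun i hi j hj h => by
  by_contra hij
  rcases Ne.lt_or_gt hij with hij | hij
  · exact hc.2.2 i j hij hj (add_left_cancel h)
  · exact hc.2.2 j i hij hi (add_left_cancel h.symm)

lemma injOn_liftVertex_Icc_one (hc : N.IsContractibleSimpleCycle l) :
    Set.InjOn (N.liftVertex a l) (Set.Icc 1 l.length) := by
  have hclosed : N.liftVertex a l l.length = N.liftVertex a l 0 := by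
    rw [liftVertex_length, hc.2.1, add_zero, liftVertex_zero]
  have h0 : 0 ∈ Set.Iio l.length := List.length_pos_iff.2 hc.1
  rintro i ⟨hi1, hi⟩ j ⟨hj1, hj⟩ h
  rcases hi.eq_or_lt with rfl | hi <;> rcases hj.eq_or_lt with rfl | hj
  · rfl
  · have := hc.injOn_liftVertex h0 hj (hclosed.symm.trans h)
    omega
  · have := hc.injOn_liftVertex hi h0 (h.trans hclosed)
    omega
  · exact hc.injOn_liftVertex hi hj h

theorem half_angleSum_coe (hl : N.IsDirectedPath l) (hc : N.IsContractibleSimpleCycle l) :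
    (((N.angleSum l + signedAngle (N.vec (l.getLast hc.1)) (N.vec (l.head hc.1))) / 2 : ℝ) :
      Real.Angle) = Real.pi := by
  obtain ⟨a, ha⟩ := N.exists_mkQ_eq_pos_src l
  have hclose := tgt_getLast_eq_src_head hl hc.1 hc.2.1
  obtain ⟨n, hn⟩ := Nat.exists_eq_add_of_le'
    (three_le_length_of_displacement_eq_zero hl hc.1 hc.2.1)
  set z := N.liftVertex a l with hz
  have hz_closed : z (n + 3) = z 0 := by
    rw [← hn, hz, liftVertex_length, hc.2.1, add_zero, liftVertex_zero]
  have hvec_last : z 0 - z (n + 2) = N.vec (l.getLast hc.1) := by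
    rw [← hz_closed, hz, liftVertex_succ_sub (by omega), List.getLast_eq_getElem]
    simp only [hn]; rfl
  have hvec_head : z 1 - z 0 = N.vec (l.head hc.1) := by
    rw [List.head_eq_getElem]; exact liftVertex_succ_sub (by omega)
  have hinit : IsSimpleArc z (n + 1) :=
    isSimpleArc_liftVertex (s := 0) hl ha (by omega)
      (hc.injOn_liftVertex.mono fun i hi => by simp at hi ⊢; omega)
  have htail : IsSimpleArc (fun i => z (i + 1)) (n + 1) :=
    isSimpleArc_liftVertex hl ha (by omega)
      (hc.injOn_liftVertex_Icc_one.mono (Set.Icc_subset_Icc_right (by omega)))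
  have hcorner : (0 : ℂ) ∉ segment ℝ (z 0 - z (n + 2)) (z 1 - z 0) := by
    rw [hvec_last, hvec_head]
    exact N.zero_notMem_segment_vec hclose
  rw [angleSum_eq_totalTurning a hn, signedAngle, ← hvec_last, ← hvec_head]
  exact IsSimpleArc.half_totalTurning_coe_of_closed hz_closed hinit htail hcorner

end IsContractibleSimpleCycle

lemma displacement_drop_take_eq_zero {i j : ℕ} (hij : i ≤ j)
    (h : N.displacement (l.take i) = N.displacement (l.take j)) :
    N.displacement ((l.take j).drop i) = 0 := by
  rw [← List.take_append_drop i (l.take j), displacement_append, List.take_take,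
    min_eq_left hij] at h
  exact left_eq_add.1 h

lemma exists_isContractibleSimpleCycle_infix (h0 : l ≠ []) (hd : N.displacement l = 0) :
    ∃ c, c <:+: l ∧ N.IsContractibleSimpleCycle c := by
  induction hn : l.length using Nat.strong_induction_on generalizing l with
  | _ n ih =>
    by_cases hl : N.IsContractibleSimpleCycle l
    · exact ⟨l, List.infix_rfl, hl⟩
    · obtain ⟨i, j, hij, hj, h⟩ : ∃ i j, i < j ∧ j < l.length ∧
          N.displacement (l.take i) = N.displacement (l.take j) := by
        simpa [IsContractibleSimpleCycle, h0, hd] using hl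
      have hlen : ((l.take j).drop i).length = j - i := by simp [hj.le]
      obtain ⟨c, hcl, hc⟩ := ih _ (by omega) (List.ne_nil_of_length_pos (by omega))
        (displacement_drop_take_eq_zero hij.le h) hlen
      exact ⟨c, hcl.trans ((List.drop_suffix _ _).isInfix.trans (List.take_prefix _ _).isInfix), hc⟩

variable {c l' : List E}

lemma IsDirectedPath.tgt_eq_src_of_append (h : N.IsDirectedPath (l ++ l')) (hl : l ≠ [])
    (hl' : l' ≠ []) : N.tgt (l.getLast hl) = N.src (l'.head hl') :=
  (List.isChain_append.1 h).2.2 _ (List.getLast_mem_getLast? hl) _ (List.head_mem_head? hl')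

lemma isDirectedPath_append_of_insert_cycle (h : N.IsDirectedPath (l ++ c ++ l')) (hc0 : c ≠ [])
    (hd : N.displacement c = 0) : N.IsDirectedPath (l ++ l') := by
  obtain ⟨hlc, hl', hout⟩ := List.isChain_append.1 h
  obtain ⟨hl, hc, hin⟩ := List.isChain_append.1 hlc
  refine List.isChain_append.2 ⟨hl, hl', fun e he f hf => ?_⟩
  rw [hin e he _ (List.head_mem_head? hc0), ← tgt_getLast_eq_src_head hc hc0 hd]
  refine hout _ ?_ f hf
  rw [List.getLast?_append_of_ne_nil _ hc0]
  exact List.getLast_mem_getLast? hc0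

lemma angleSum_append (hl : l ≠ []) (hl' : l' ≠ []) :
    N.angleSum (l ++ l') = N.angleSum l +
      signedAngle (N.vec (l.getLast hl)) (N.vec (l'.head hl')) + N.angleSum l' := by
  obtain ⟨f, t', rfl⟩ := List.exists_cons_of_ne_nil hl'
  induction l with
  | nil => exact absurd rfl hl
  | cons e t ih =>
    match t with
    | [] => simp [angleSum]
    | g :: t =>
      have ih := ih (List.cons_ne_nil g t)
      simp only [List.cons_append, angleSum] at ih ⊢
      rw [ih, List.getLast_cons (List.cons_ne_nil g t)]
      ring

-- The cycle is inserted at a vertex with a single incoming edge, at which both the path and the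
-- cycle arrive, or with a single outgoing edge, along which both of them leave.
lemma angleSum_insert_cycle (hl : l ≠ []) (hl' : l' ≠ []) (h : N.IsDirectedPath (l ++ c ++ l'))
    (hc0 : c ≠ []) (hd : N.displacement c = 0) :
    N.angleSum (l ++ c ++ l') = N.angleSum (l ++ l') +
      (N.angleSum c + signedAngle (N.vec (c.getLast hc0)) (N.vec (c.head hc0))) := by
  have hlc : N.IsDirectedPath (l ++ c) := h.left_of_append
  have hin := hlc.tgt_eq_src_of_append hl hc0
  have hout := h.tgt_eq_src_of_append (by simp [hl]) hl'
  have hclose := tgt_getLast_eq_src_head hlc.right_of_append hc0 hd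
  rw [List.getLast_append_of_ne_nil _ hc0] at hout
  rw [angleSum_append (by simp [hl]) hl', angleSum_append hl hc0, angleSum_append hl hl',
    List.getLast_append_of_ne_nil _ hc0]
  cases hcol : N.color (N.src (c.head hc0))
  · rw [(N.white_in _ hcol).unique hin hclose]
    ring
  · rw [(N.black_out _ hcol).unique rfl (hout.symm.trans hclose)]
    ring

lemma exp_half_angleSum_insert_cycle (hl : l ≠ []) (hl' : l' ≠ [])
    (h : N.IsDirectedPath (l ++ c ++ l')) (hc : N.IsContractibleSimpleCycle c) :
    exp (I / 2 * (N.angleSum (l ++ c ++ l') : ℂ)) = -exp (I / 2 * (N.angleSum (l ++ l') : ℂ)) := by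
  have hcycle := congrArg (fun θ : Real.Angle => (θ.toCircle : ℂ))
    (hc.half_angleSum_coe h.left_of_append.right_of_append)
  simp only [Real.Angle.toCircle_coe, Circle.coe_exp, exp_pi_mul_I] at hcycle
  rw [angleSum_insert_cycle hl hl' h hc.1 hc.2.1, ofReal_add, mul_add, exp_add, ← mul_neg_one,
    ← hcycle]
  push_cast
  ring_nf

lemma color_tgt_of_black {e : E} (h : N.color (N.src e) = VertexColor.black) :
    N.color (N.tgt e) = VertexColor.white := by
  have hb := N.bipartite e
  cases ht : N.color (N.tgt e)
  · rfl
  · exact absurd (h.trans ht.symm) hb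

variable (N) in
open Classical in
/-- The contribution of an edge to the product of turning numbers. -/
noncomputable def edgeTurn (e : E) : ℂ :=
  if h : N.color (N.src e) = VertexColor.white then N.turn e h else 1

lemma edgeTurn_of_black {e : E} (h : N.color (N.src e) = VertexColor.black) :
    N.edgeTurn e = 1 := dif_neg (by simp [h])

lemma edgeTurn_of_white {e f g : E} (h : N.color (N.src f) = VertexColor.white)
    (he : N.tgt e = N.src f) (hg : N.tgt f = N.src g) :
    N.edgeTurn f = exp (I / 2 *
      ((signedAngle (N.vec e) (N.vec f) + signedAngle (N.vec f) (N.vec g) : ℝ) : ℂ)) := by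
  have hpred : N.predEdge f h = e :=
    (N.white_in _ h).unique (N.white_in _ h).choose_spec.1 he
  have hblack := N.black_out (N.tgt f) (N.color_tgt_of_white h)
  have hsucc : N.succEdge f h = g := hblack.unique hblack.choose_spec.1 hg.symm
  rw [edgeTurn, dif_pos h, turn, hpred, hsucc]

lemma prod_map_edgeTurn {l : List E} (h0 : l ≠ []) (hl : N.IsDirectedPath l)
    (hhead : N.color (N.src (l.head h0)) = VertexColor.black)
    (hlast : N.color (N.src (l.getLast h0)) = VertexColor.black) :
    (l.map N.edgeTurn).prod = exp (I / 2 * (N.angleSum l : ℂ)) := by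
  match l with
  | [e] =>
    have he : N.color (N.src e) = VertexColor.black := hhead
    simp [angleSum, edgeTurn_of_black he]
  | [e, f] =>
    have hef : N.tgt e = N.src f := by simpa using hl
    have hwhite : N.color (N.src f) = VertexColor.white := hef ▸ color_tgt_of_black hhead
    exact absurd (hwhite.symm.trans hlast) (by simp)
  | e :: f :: g :: t =>
    have he : N.color (N.src e) = VertexColor.black := hhead
    obtain ⟨hef, hl⟩ := List.isChain_cons_cons.1 hl
    obtain ⟨hfg, hl⟩ := List.isChain_cons_cons.1 hl
    have hf : N.color (N.src f) = VertexColor.white := hef ▸ color_tgt_of_black he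
    have hg : N.color (N.src g) = VertexColor.black := hfg ▸ N.color_tgt_of_white hf
    have ih := prod_map_edgeTurn (List.cons_ne_nil g t) hl hg hlast
    rw [List.map_cons, List.map_cons, List.prod_cons, List.prod_cons, ih,
      edgeTurn_of_black he, edgeTurn_of_white hf hef hfg, one_mul, ← exp_add]
    simp only [angleSum]
    push_cast
    ring_nf
termination_by l.length

namespace IsNormalized

variable {R : SimpleLoop Λ} {v : ℂ} {e : E} {x : ℂ}

lemma height_ne_zero (hN : N.IsNormalized R v) {F : ℂ → ℝ} (hF : R.IsHeight v F) {p : V}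
    (hx : Λ.mkQ x = N.pos p) : F x ≠ 0 := fun h0 => by
  obtain ⟨s, hs⟩ := hF.mem_rim x h0
  exact hN.vertices_off_rim p s (hx.symm.trans hs)

lemma dir_ne_zero (hN : N.IsNormalized R v) (he : N.Crosses R e) : v ≠ 0 := by
  rintro rfl
  obtain ⟨c, -, hvec⟩ := hN.parallel e he
  exact N.vec_ne_zero e (by rw [hvec, smul_zero])

lemma arg_vec_div (hN : N.IsNormalized R v) (he : N.Crosses R e) : arg (N.vec e / v) = 0 := by
  obtain ⟨c, hc, hvec⟩ := hN.parallel e he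
  rw [hvec, real_smul, mul_div_cancel_right₀ _ (hN.dir_ne_zero he), arg_ofReal_of_nonneg hc.le]

lemma exists_isHeight (hN : N.IsNormalized R v) (he : N.Crosses R e)
    (hx : Λ.mkQ x = N.pos (N.src e)) :
    ∃ F, R.IsHeight v F ∧ F x < 0 ∧ 0 < F (x + N.vec e) := by
  obtain ⟨F₀, hF₀, hrim⟩ := SimpleLoop.exists_isHeight (hN.dir_ne_zero he) hN.transversal
  obtain ⟨c, hc, hvec⟩ := hN.parallel e he
  obtain ⟨t, ht0, ht1, s, hs⟩ := he
  have hd : R.lift s - (x + t • N.vec e) ∈ Λ := by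
    rw [← Submodule.Quotient.mk_eq_zero, ← Submodule.mkQ_apply, map_sub, map_add, hx, hs, sub_self]
  have hF := hF₀.comp_add hd
  set F : ℂ → ℝ := fun z => F₀ (z + (R.lift s - (x + t • N.vec e))) with hF_def
  have hcrossing : F x + t * c = 0 := by
    rw [← hF.map_add_smul, ← smul_smul, ← hvec, hF_def]
    simp only [add_sub_cancel, hrim]
  have htgt : F (x + N.vec e) = F x + c := by rw [hvec, hF.map_add_smul]
  have hx_ne : F x ≠ 0 := hN.height_ne_zero hF hx
  have hy_ne : F (x + N.vec e) ≠ 0 :=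
    hN.height_ne_zero hF (p := N.tgt e) (by rw [map_add, hx, N.pos_tgt])
  have htc : 0 ≤ t * c := mul_nonneg ht0 hc.le
  have htc' : t * c ≤ c := mul_le_of_le_one_left hc.le ht1
  exact ⟨F, hF, lt_of_le_of_ne (by linarith) hx_ne, lt_of_le_of_ne (by linarith) hy_ne.symm⟩

lemma height_mem_Icc (hN : N.IsNormalized R v) {F : ℂ → ℝ} (hF : R.IsHeight v F)
    (he : N.Crosses R e) {y : ℂ} (hy : y ∈ segment ℝ x (x + N.vec e)) :
    F y ∈ Set.Icc (F x) (F (x + N.vec e)) := by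
  obtain ⟨c, hc, hvec⟩ := hN.parallel e he
  obtain ⟨t, ht0, ht1, rfl⟩ := mem_segment_self_add_iff.1 hy
  rw [hvec, smul_smul, hF.map_add_smul, hF.map_add_smul]
  exact ⟨le_add_of_nonneg_right (mul_nonneg ht0 hc.le),
    add_le_add_right (mul_le_of_le_one_left hc.le ht1) _⟩

end IsNormalized

lemma sign_height_eq_of_not_crosses {R : SimpleLoop Λ} {v : ℂ} {F : ℂ → ℝ} (hF : R.IsHeight v F)
    {e : E} (he : ¬ N.Crosses R e) {x : ℂ} (hx : Λ.mkQ x = N.pos (N.src e)) {y : ℂ}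
    (hy : y ∈ segment ℝ x (x + N.vec e)) : SignType.sign (F y) = SignType.sign (F x) := by
  refine sign_eq_sign_of_isPreconnected hF.continuous
    (convex_segment x (x + N.vec e)).isPreconnected (fun z hz h0 => ?_) hy (left_mem_segment ℝ _ _)
  obtain ⟨t, ht0, ht1, rfl⟩ := mem_segment_self_add_iff.1 hz
  obtain ⟨s, hs⟩ := hF.mem_rim _ h0
  exact he ⟨t, ht0, ht1, s, by rw [← hx, ← map_add, hs]⟩

namespace CylinderPath

variable {R : SimpleLoop Λ} {v : ℂ}

/-- All edges of a path from a source to a sink, including the two crossing edges of which the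
path only contains a half. -/
def edges (γ : N.CylinderPath R) : List E := γ.source :: (γ.mid ++ [γ.sink])

lemma turnProduct_eq (hN : N.IsNormalized R v) (γ : N.CylinderPath R) :
    γ.turnProduct = exp (I / 2 * (N.angleSum γ.edges : ℂ)) := by
  refine prod_map_edgeTurn (List.cons_ne_nil _ _) γ.chain
    (hN.black_to_white _ γ.source_crosses) ?_
  rw [List.getLast_cons (by simp), List.getLast_append_singleton]
  exact hN.black_to_white _ γ.sink_crosses

lemma turnProduct_of_decomposesInto (hN : N.IsNormalized R v) {γ γ' : N.CylinderPath R}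
    (h : γ.DecomposesInto γ') : γ.turnProduct = -γ'.turnProduct := by
  obtain ⟨hsource, hsink, a, c, b, hmid, hmid', hc⟩ := h
  have hγ : γ.edges = (γ.source :: a) ++ c ++ (b ++ [γ.sink]) := by simp [edges, hmid]
  have hγ' : γ'.edges = (γ.source :: a) ++ (b ++ [γ.sink]) := by
    simp [edges, hmid', hsource, hsink]
  rw [turnProduct_eq hN, turnProduct_eq hN, hγ, hγ']
  exact exp_half_angleSum_insert_cycle (by simp) (by simp) (hγ ▸ γ.chain) hc

lemma exists_decomposesInto {γ : N.CylinderPath R} (h : ¬ γ.IsSimple) :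
    ∃ γ' : N.CylinderPath R, γ.DecomposesInto γ' ∧ γ'.mid.length < γ.mid.length := by
  obtain ⟨i, j, hij, hj, hd⟩ : ∃ i j, i < j ∧ j ≤ γ.mid.length ∧
      N.displacement (γ.mid.take i) = N.displacement (γ.mid.take j) := by
    simpa [IsSimple] using h
  obtain ⟨c, hinfix, hc⟩ := exists_isContractibleSimpleCycle_infix
    (List.ne_nil_of_length_pos (by simp only [List.length_drop, List.length_take]; omega))
    (displacement_drop_take_eq_zero hij.le hd)
  obtain ⟨a, b, hmid⟩ :=
    hinfix.trans ((List.drop_suffix _ _).isInfix.trans (List.take_prefix _ _).isInfix)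
  have hchain : N.IsDirectedPath ((γ.source :: a) ++ c ++ (b ++ [γ.sink])) := by
    have := γ.chain
    rw [← hmid] at this
    simpa using this
  refine ⟨⟨γ.source, a ++ b, γ.sink, γ.source_crosses, γ.sink_crosses,
    fun e he => γ.mid_not_crosses e ?_, ?_⟩, ⟨rfl, rfl, a, c, b, hmid.symm, rfl, hc⟩, ?_⟩
  · rw [← hmid]
    simp only [List.mem_append] at he ⊢
    tauto
  · simpa using isDirectedPath_append_of_insert_cycle hchain hc.1 hc.2.1
  · have := List.length_pos_iff.2 hc.1
    simp only [← hmid, List.length_append]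
    omega

lemma exists_hasSign (γ : N.CylinderPath R) : ∃ ε, HasSign γ ε := by
  induction hn : γ.mid.length using Nat.strong_induction_on generalizing γ with
  | _ n ih =>
    by_cases h : γ.IsSimple
    · exact ⟨1, HasSign.simple γ h⟩
    · obtain ⟨γ', hd, hlt⟩ := exists_decomposesInto h
      obtain ⟨ε, hε⟩ := ih _ (hn ▸ hlt) γ' rfl
      exact ⟨-ε, HasSign.cycle γ γ' ε hd hε⟩

variable {γ : N.CylinderPath R}

lemma length_edges : γ.edges.length = γ.mid.length + 2 := by
  simp [edges]

lemma getElem_edges_succ {i : ℕ} (hi : i < γ.mid.length) :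
    γ.edges[i + 1]'(by rw [length_edges]; omega) = γ.mid[i] := by
  simp [edges, List.getElem_append_left hi]

lemma getElem_edges_last :
    γ.edges[γ.mid.length + 1]'(by rw [length_edges]; omega) = γ.sink := by
  simp [edges]

lemma mkQ_liftVertex_edges (ha : Λ.mkQ a = N.pos (N.src γ.source)) {i : ℕ}
    (hi : i < γ.edges.length) : Λ.mkQ (N.liftVertex a γ.edges i) = N.pos (N.src γ.edges[i]) :=
  mkQ_liftVertex γ.chain (fun _ => ha) hi

lemma liftVertex_edges_one :
    N.liftVertex a γ.edges 1 = N.liftVertex a γ.edges 0 + N.vec γ.source :=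
  liftVertex_succ (by simp [edges])

lemma liftVertex_edges_last : N.liftVertex a γ.edges (γ.mid.length + 2) =
    N.liftVertex a γ.edges (γ.mid.length + 1) + N.vec γ.sink := by
  rw [liftVertex_succ (by rw [length_edges]; omega), getElem_edges_last]

lemma liftVertex_edges_succ {i : ℕ} (hi : i ≤ γ.mid.length) :
    N.liftVertex a γ.edges (i + 1) = a + N.vec γ.source + N.displacement (γ.mid.take i) := by
  rw [edges, liftVertex_cons_succ, liftVertex, List.take_append_of_le_length hi]

lemma sign_height_eq_of_mem_segment {F : ℂ → ℝ} (hF : R.IsHeight v F)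
    (ha : Λ.mkQ a = N.pos (N.src γ.source)) {i : ℕ} (hi : i < γ.mid.length) {x : ℂ}
    (hx : x ∈ segment ℝ (N.liftVertex a γ.edges (i + 1)) (N.liftVertex a γ.edges (i + 2))) :
    SignType.sign (F x) = SignType.sign (F (N.liftVertex a γ.edges (i + 1))) := by
  have hi' : i + 1 < γ.edges.length := by rw [length_edges]; omega
  rw [liftVertex_succ hi', getElem_edges_succ hi] at hx
  refine sign_height_eq_of_not_crosses hF (γ.mid_not_crosses _ (List.getElem_mem hi)) ?_ hx
  rw [mkQ_liftVertex_edges ha hi', getElem_edges_succ hi]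

lemma sign_height_liftVertex {F : ℂ → ℝ} (hF : R.IsHeight v F)
    (ha : Λ.mkQ a = N.pos (N.src γ.source)) {i : ℕ} (hi : i ≤ γ.mid.length) :
    SignType.sign (F (N.liftVertex a γ.edges (i + 1))) =
      SignType.sign (F (N.liftVertex a γ.edges 1)) := by
  induction i with
  | zero => rfl
  | succ i ih =>
    rw [sign_height_eq_of_mem_segment hF ha hi (right_mem_segment ℝ _ _), ih (by omega)]

lemma exists_isHeight_source (hN : N.IsNormalized R v)
    (ha : Λ.mkQ a = N.pos (N.src γ.source)) :
    ∃ F, R.IsHeight v F ∧ F (N.liftVertex a γ.edges 0) < 0 ∧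
      ∀ i ≤ γ.mid.length, ∀ x ∈ segment ℝ (N.liftVertex a γ.edges (i + 1))
        (N.liftVertex a γ.edges (i + 2)), 0 < F x := by
  have hfirst : Λ.mkQ (N.liftVertex a γ.edges 0) = N.pos (N.src γ.source) := by
    rw [liftVertex_zero, ha]
  obtain ⟨F, hF, hneg, hpos⟩ := hN.exists_isHeight γ.source_crosses hfirst
  rw [← liftVertex_edges_one] at hpos
  have hvertex {i : ℕ} (hi : i ≤ γ.mid.length) : 0 < F (N.liftVertex a γ.edges (i + 1)) := by
    rwa [← sign_eq_one_iff, sign_height_liftVertex hF ha hi, sign_eq_one_iff]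
  refine ⟨F, hF, hneg, fun i hi x hx => ?_⟩
  rcases hi.lt_or_eq with hi | rfl
  · rw [← sign_eq_one_iff, sign_height_eq_of_mem_segment hF ha hi hx, sign_eq_one_iff]
    exact hvertex hi.le
  · rw [liftVertex_edges_last] at hx
    exact (hvertex le_rfl).trans_le (hN.height_mem_Icc hF γ.sink_crosses hx).1

lemma exists_isHeight_sink (hN : N.IsNormalized R v)
    (ha : Λ.mkQ a = N.pos (N.src γ.source)) :
    ∃ F, R.IsHeight v F ∧ 0 < F (N.liftVertex a γ.edges (γ.mid.length + 2)) ∧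
      ∀ i ≤ γ.mid.length, ∀ x ∈ segment ℝ (N.liftVertex a γ.edges i)
        (N.liftVertex a γ.edges (i + 1)), F x < 0 := by
  have hlen : γ.mid.length + 1 < γ.edges.length := by rw [length_edges]; omega
  have hlast : Λ.mkQ (N.liftVertex a γ.edges (γ.mid.length + 1)) = N.pos (N.src γ.sink) := by
    rw [mkQ_liftVertex_edges ha hlen, getElem_edges_last]
  obtain ⟨F, hF, hneg, hpos⟩ := hN.exists_isHeight γ.sink_crosses hlast
  rw [← liftVertex_edges_last] at hpos
  have hvertex {i : ℕ} (hi : i ≤ γ.mid.length) : F (N.liftVertex a γ.edges (i + 1)) < 0 := by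
    rwa [← sign_eq_neg_one_iff, sign_height_liftVertex hF ha hi,
      ← sign_height_liftVertex hF ha le_rfl, sign_eq_neg_one_iff]
  refine ⟨F, hF, hpos, fun i hi x hx => ?_⟩
  rcases i with _ | i
  · have hone := hvertex (Nat.zero_le _)
    rw [zero_add, liftVertex_edges_one] at hx hone
    exact (hN.height_mem_Icc hF γ.source_crosses hx).2.trans_lt hone
  · rw [← sign_eq_neg_one_iff, sign_height_eq_of_mem_segment hF ha hi hx, sign_eq_neg_one_iff]
    exact hvertex (by omega)

lemma IsSimple.injOn_liftVertex (h : γ.IsSimple) (hN : N.IsNormalized R v)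
    (ha : Λ.mkQ a = N.pos (N.src γ.source)) :
    Set.InjOn (N.liftVertex a γ.edges) (Set.Icc 0 (γ.mid.length + 2)) := by
  obtain ⟨F, -, hFneg, hFpos⟩ := exists_isHeight_source hN ha
  obtain ⟨G, -, hGpos, hGneg⟩ := exists_isHeight_sink hN ha
  have hne {i j : ℕ} (hij : i < j) (hj : j ≤ γ.mid.length + 2) :
      N.liftVertex a γ.edges i ≠ N.liftVertex a γ.edges j := fun heq => by
    rcases hj.eq_or_lt with rfl | hj
    · have : G (N.liftVertex a γ.edges i) < 0 := by
        rcases i with _ | i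
        · exact hGneg 0 (Nat.zero_le _) _ (left_mem_segment ℝ _ _)
        · exact hGneg i (by omega) _ (right_mem_segment ℝ _ _)
      exact lt_asymm hGpos (heq ▸ this)
    · obtain ⟨j, rfl⟩ := Nat.exists_eq_add_of_lt (Nat.zero_lt_of_lt hij)
      rw [zero_add] at hij hj heq
      rcases i with _ | i
      · have := hFpos j (by omega) _ (left_mem_segment ℝ _ _)
        exact lt_asymm hFneg (heq ▸ this)
      · rw [liftVertex_edges_succ (by omega), liftVertex_edges_succ (by omega)] at heq
        exact h i j (by omega) (by omega) (add_left_cancel heq)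
  rintro i ⟨-, hi⟩ j ⟨-, hj⟩ heq
  rcases lt_trichotomy i j with hij | hij | hij
  exacts [absurd heq (hne hij hj), hij, absurd heq.symm (hne hij hi)]

theorem IsSimple.angleSum_edges (h : γ.IsSimple) (hN : N.IsNormalized R v) :
    N.angleSum γ.edges = 0 := by
  obtain ⟨a, ha⟩ := Λ.mkQ_surjective (N.pos (N.src γ.source))
  obtain ⟨F, hF, hFneg, hFpos⟩ := exists_isHeight_source hN ha
  obtain ⟨G, hG, hGpos, hGneg⟩ := exists_isHeight_sink hN ha
  have harc : IsSimpleArc (N.liftVertex a γ.edges) (γ.mid.length + 1) :=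
    isSimpleArc_liftVertex (l := γ.edges) (s := 0) γ.chain (fun _ => ha)
      (by rw [length_edges]; omega)
      (h.injOn_liftVertex hN ha)
  have hfirst : N.liftVertex a γ.edges 1 - N.liftVertex a γ.edges 0 = N.vec γ.source := by
    rw [liftVertex_edges_one, add_sub_cancel_left]
  have hlast : N.liftVertex a γ.edges (γ.mid.length + 2) -
      N.liftVertex a γ.edges (γ.mid.length + 1) = N.vec γ.sink := by
    rw [liftVertex_edges_last, add_sub_cancel_left]
  rw [angleSum_eq_totalTurning a length_edges]
  refine harc.totalTurning_eq_zero (v := v) ?_ ?_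
    (fun i hi x hx => hF.zero_notMem_segment (hFneg.trans (hFpos i (by omega) x hx)))
    (fun i hi x hx => hG.zero_notMem_segment ((hGneg i (by omega) x hx).trans hGpos))
  · rw [hfirst, hN.arg_vec_div γ.source_crosses]
  · rw [hlast, hN.arg_vec_div γ.sink_crosses]

end CylinderPath

lemma HasSign.coe_eq_turnProduct {R : SimpleLoop Λ} {v : ℂ} (hN : N.IsNormalized R v)
    {γ : N.CylinderPath R} {ε : ℤˣ} (h : HasSign γ ε) : ((ε : ℤ) : ℂ) = γ.turnProduct := by
  induction h with
  | simple γ h =>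
    rw [CylinderPath.turnProduct_eq hN, h.angleSum_edges hN]
    simp
  | cycle γ γ' ε hd _ ih =>
    rw [CylinderPath.turnProduct_of_decomposesInto hN hd, ← ih]
    simp

end FlatPerfectNetwork

end Network

theorem proposition4_general (Λ : Submodule ℤ ℂ) {V E : Type*} (N : FlatPerfectNetwork Λ V E)
    (R : SimpleLoop Λ) (v : ℂ) (hN : N.IsNormalized R v) (γ : N.CylinderPath R) :
    ∃ ε : ℤˣ, (∀ δ : ℤˣ, FlatPerfectNetwork.HasSign γ δ ↔ δ = ε) ∧
      ((ε : ℤ) : ℂ) = γ.turnProduct := by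
  obtain ⟨ε, hε⟩ := γ.exists_hasSign
  have h := hε.coe_eq_turnProduct hN
  refine ⟨ε, fun δ => ⟨fun hδ => ?_, fun hδ => hδ ▸ hε⟩, h⟩
  exact Units.ext (Int.cast_injective ((hδ.coe_eq_turnProduct hN).trans h.symm))

theorem proposition4 (Λ : Submodule ℤ ℂ) [DiscreteTopology Λ] [IsZLattice ℝ Λ]
    {V E : Type*} [Finite V] [Finite E] (N : FlatPerfectNetwork Λ V E)
    (R : SimpleLoop Λ) (v : ℂ) (hN : N.IsNormalized R v) (γ : N.CylinderPath R) :
    ∃ ε : ℤˣ, (∀ δ : ℤˣ, FlatPerfectNetwork.HasSign γ δ ↔ δ = ε) ∧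
      ((ε : ℤ) : ℂ) = γ.turnProduct :=
  proposition4_general Λ N R v hN γ
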